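/- Let $F(X)=X^d+a_1X^{d-1}+\dots+a_d\in\mathbb Z[X]$ ($d\ge 1$) be monic and irreducible, let $\alpha$ be a root of $F$, and write $x\mapsto x^{(1)},\dots,x^{(d)}$ for the $d$ embeddings of $\mathbb Q(\alpha)$ into $\mathbb C$. Call $x\in\mathbb Q(\alpha)$ totally positive if its image under every real embedding is positive. Two invertible fractional ideals of $\mathbb Z[\alpha]$ are in the same narrow class if they differ by a nonzero totally positive factor $\xi\in\mathbb Q(\alpha)$. Fix an integral invertible ideal $I_l\subset\mathbb Z[\alpha]$ in each narrow class $l$ ($1\le l\le h^+(\alpha)$), a $\mathbb Z$-basis $\beta_{l1},\dots,\beta_{ld}$ of $I_l$ and a $\mathbb Z$-basis $\overline\beta_{l1},\dots,\overline\beta_{ld}$ of $I_l^{-1}$. Here the index $l=1$ denotes the trivial class, and $I_1=\mathbb Z[\alpha]$ with basis $\beta_{1j}=\alpha^{d-j}$. Put $\mathfrak B_l=(\beta_{lj}^{(k)})_{1\le j,k\le d}$ and assume that $\det\mathfrak B_l/\det\mathfrak B_1>0$ for all $l$. Let $B_{li}$ be the integral matrix with $(j,k)$ entry $b_{ijkl}$,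 where $$\overline\beta_{li}\beta_{lj}=\sum_{k=1}^d b_{ijkl}\,\alpha^{d-k}.$$ Fix a set $\mathcal D$ of totally positive elements of $\mathbb Q(\alpha)$ that contains exactly one element of each orbit of the totally positive units of $\mathbb Z[\alpha]$ acting by multiplication on the nonzero totally positive elements. For $m\in\mathbb Z_{>0}$ and $r=(r_1,\dots,r_{d-1})\in\mathbb Z^{d-1}$ let $$M(m,r)=\begin{pmatrix}1&\cdots&0&-r_{d-1}\\ \vdots&\ddots&\vdots&\vdots\\ 0&\cdots&1&-r_1\\ 0&\cdots&0&m\end{pmatrix}.$$ For an index $l$ and integers $c=(c_1,\dots,c_d)$ put $C=\sum_i c_iB_{li}$ and $\xi=\sum_i c_i\overline\beta_{li}$, and let $C_{jd}$ be $C$ with row $j$ and column $d$ removed (the determinant of a $0\times 0$ matrix is $1$). Call $(l,c)$ admissible if $\xi\in\mathcal D$ and $\gcd(\det C_{1d},\dots,\det C_{dd})=1$. Call $u\in\mathbb Z^d$ a Bezout column for $(l,c)$ if $\sum_{j}(-1)^{j+d}u_j\det C_{jd}=1$. For $u\in\mathbb Z^d$ write $(l,c,u)\to(m,r)$ if the matrix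 obtained from $C$ by replacing its last column by $u$ is $\gamma^{-1}$ for some $\gamma\in\mathrm{SL}(d,\mathbb Z)$ with $$\gamma\,\mathfrak B_l\,\mathrm{diag}(\xi^{(1)},\dots,\xi^{(d)})=M(m,r)\,\mathfrak B_1\quad\text{and}\quad M(m,r)=\gamma C .$$ **(a)** Let $(l,c)$ be admissible. Then there are a positive integer $m$ and an integer $\mu$ with $F(\mu)\equiv 0\pmod m$ such that: Bezout columns $u$ exist; for every Bezout column $u$ there is a unique $r$ with $r_j\equiv\mu^j\pmod m$ for $1\le j\le d-1$ and $(l,c,u)\to(m,r)$; and conversely every $r\in\mathbb Z^{d-1}$ with $r_j\equiv\mu^j\pmod m$ for all $j$ (in particular $r_j=\mu^j$) arises in this way from a unique Bezout column $u$. **(b)** Let $m>0$ and $\mu$ be integers with $F(\mu)\equiv 0\pmod m$ such that the lattice with basis $\alpha^{d-1}-\mu^{d-1},\dots,\alpha-\mu,\,m$ is an invertible ideal of $\mathbb Z[\alpha]$. Then there is an admissible $(l,c)$ for which all the assertions of (a) hold with this $m$ and $\mu$. Moreover $(l,c)$ is unique: if $(l',c')$ is admissible and $(l',c',u)\to(m,r)$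 for some Bezout column $u$ of $(l',c')$ and some $r$ with $r_j\equiv\mu^j\pmod m$ for all $j$, then $l'=l$ and $c'=c$. -/

import Mathlib

open Polynomial
open scoped nonZeroDivisors

namespace RootParam

noncomputable section

/-- The order `ℤ[α] = ℤ[X]/(F)`. -/
abbrev Order (F : ℤ[X]) : Type := AdjoinRoot F

instance instIsDomainOrder (F : ℤ[X]) [hF : Fact (Irreducible F)] : IsDomain (Order F) :=
  AdjoinRoot.isDomain_of_prime hF.out.prime

/-- The field `ℚ(α)`, as the field of fractions of `ℤ[α]`. -/
abbrev Fld (F : ℤ[X]) : Type := FractionRing (Order F)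

section

variable (F : ℤ[X]) [Fact (Irreducible F)]

/-- The root `α` of `F`, in the order. -/
abbrev alpha : Order F := AdjoinRoot.root F

variable {F}

/-- `x ∈ ℚ(α) ∩ C⁺_{r₁,r₂}`: the image of `x` under every real embedding is positive. -/
def TotPos (x : Fld F) : Prop := ∀ φ : Fld F →+* ℝ, 0 < φ x

variable (F)

/-- The multiplicative group of nonzero elements of `ℚ(α)` that are positive at all real
embeddings. -/
def totPosUnits : Subgroup (Fld F)ˣ where
  carrier := {x | TotPos (x : Fld F)}
  one_mem' := fun φ => by simp
  mul_mem' := fun {a b} ha hb φ => by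
    rw [Units.val_mul, map_mul]
    exact mul_pos (ha φ) (hb φ)
  inv_mem' := fun {a} ha φ => by
    rw [Units.val_inv_eq_inv_val, map_inv₀]
    exact inv_pos.mpr (ha φ)

/-- The narrow class group of `ℤ[α]`: invertible fractional ideals modulo the principal ones
that are generated by an element positive at all real embeddings. -/
abbrev NarrowClassGroup : Type :=
  (FractionalIdeal (Order F)⁰ (Fld F))ˣ ⧸
    (totPosUnits F).map (toPrincipalIdeal (Order F) (Fld F))

variable {F}

/-- `D ⊆ ℚ(α) ∩ C⁺` is a (strict) fundamental domain for the multiplicative action of the totally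
positive units of `ℤ[α]`: it contains exactly one point of the orbit of every nonzero element. -/
structure IsFundDomain (D : Set (Fld F)) : Prop where
  totPos : ∀ x ∈ D, TotPos x
  existsUnique : ∀ x : Fld F, x ≠ 0 → TotPos x →
    ∃! y, y ∈ D ∧ ∃ ε : (Order F)ˣ,
      TotPos (algebraMap (Order F) (Fld F) ε) ∧ y = algebraMap (Order F) (Fld F) ε * x

/-- The matrix with rows the vectors of embeddings `(x^{(1)}, …, x^{(d)})` of the `x j`,
with respect to the enumeration `σ` of the embeddings. -/
def embMatrix {n : ℕ} (σ : Fin (n + 1) ≃ (Fld F →+* ℂ)) (x : Fin (n + 1) → Fld F) :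
    Matrix (Fin (n + 1)) (Fin (n + 1)) ℂ :=
  Matrix.of fun j k => σ k (x j)

variable (F)

/-- The choices fixed once and for all for the polynomial `F` of degree `d = n + 1`:
an enumeration of the complex embeddings, integral representatives `I l` of the narrow ideal classes
`l` with `ℤ`-bases of `I l` and of `(I l)⁻¹`, and a fundamental domain for the totally positive
units. -/
structure Choices (n : ℕ) where
  /-- the embeddings `x ↦ x^{(1)}, …, x^{(d)}` -/
  σ : Fin (n + 1) ≃ (Fld F →+* ℂ)
  /-- the integral representative of a narrow class -/
  I : NarrowClassGroup F → Ideal (Order F)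
  isUnit_I : ∀ l, IsUnit (I l : FractionalIdeal (Order F)⁰ (Fld F))
  class_I : ∀ l, ((isUnit_I l).unit : NarrowClassGroup F) = l
  /-- the basis `β_{l1}, …, β_{ld}` of `I l` -/
  β : ∀ l, Module.Basis (Fin (n + 1)) ℤ (I l)
  /-- the trivial class is represented by `ℤ[α]` with the basis `α^{d-1}, …, α, 1` -/
  I_one : I 1 = ⊤
  β_one : ∀ j : Fin (n + 1), (β 1 j : Order F) = alpha F ^ (n - (j : ℕ))
  /-- `det 𝔅_l` and `det 𝔅_1` have the same sign, i.e. their quotient is a positive real -/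
  sign_det : ∀ l, ∃ t : ℝ, 0 < t ∧
    (embMatrix σ fun j => algebraMap (Order F) (Fld F) (β l j)).det =
      t * (embMatrix σ fun j => algebraMap (Order F) (Fld F) (β 1 j)).det
  /-- the basis of `(I l)⁻¹` -/
  βbar : ∀ l, Module.Basis (Fin (n + 1)) ℤ
    (((I l : FractionalIdeal (Order F)⁰ (Fld F))⁻¹ : FractionalIdeal (Order F)⁰ (Fld F)) :
      Submodule (Order F) (Fld F))
  /-- the fundamental domain -/
  D : Set (Fld F)
  isFundDomain : IsFundDomain D

variable {F}

namespace Choices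

variable {n : ℕ} (S : Choices F n)

/-- The matrix `𝔅_l`. -/
def frakB (l : NarrowClassGroup F) : Matrix (Fin (n + 1)) (Fin (n + 1)) ℂ :=
  embMatrix S.σ fun j => algebraMap (Order F) (Fld F) (S.β l j)

theorem exists_prod (l : NarrowClassGroup F) (i j : Fin (n + 1)) :
    ∃ y : Order F, algebraMap (Order F) (Fld F) y =
      (S.βbar l i : Fld F) * algebraMap (Order F) (Fld F) (S.β l j) := by
  have h0 : (S.I l : FractionalIdeal (Order F)⁰ (Fld F)) ≠ 0 := (S.isUnit_I l).ne_zero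
  have h1 := (FractionalIdeal.mem_inv_iff h0).mp (S.βbar l i).2
    (algebraMap (Order F) (Fld F) (S.β l j))
    ((FractionalIdeal.mem_coeIdeal _).mpr ⟨_, (S.β l j).2, rfl⟩)
  exact (FractionalIdeal.mem_one_iff _).mp h1

/-- The matrix `B_{li}`: its `(j, k)` entry is the coefficient of `α^{d-k}` (indices from `1`) in
`βbar_{li} β_{lj} ∈ ℤ[α]`. -/
def B (hF : F.Monic) (l : NarrowClassGroup F) (i : Fin (n + 1)) :
    Matrix (Fin (n + 1)) (Fin (n + 1)) ℤ :=
  Matrix.of fun j k =>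
    (AdjoinRoot.modByMonicHom hF (S.exists_prod l i j).choose).coeff (n - (k : ℕ))

/-- The defining property of the entries of `B_{li}`. -/
theorem B_spec (hF : F.Monic) (hn : F.natDegree = n + 1) (l : NarrowClassGroup F)
    (i j : Fin (n + 1)) :
    (S.βbar l i : Fld F) * algebraMap (Order F) (Fld F) (S.β l j) =
      ∑ k : Fin (n + 1),
        (S.B hF l i j k : Fld F) * algebraMap (Order F) (Fld F) (alpha F ^ (n - (k : ℕ))) := by
  have key : ∀ y : Order F, y = ∑ k : Fin (n + 1),
      (((AdjoinRoot.modByMonicHom hF y).coeff (n - (k : ℕ)) : ℤ) : Order F) *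
        alpha F ^ (n - (k : ℕ)) := by
    intro y
    obtain ⟨p, rfl⟩ := AdjoinRoot.mk_surjective y
    have hne : F ≠ 1 := fun h => by simp [h] at hn
    have hlt : (p %ₘ F).natDegree < n + 1 := hn ▸ natDegree_modByMonic_lt p hF hne
    have h1 : AdjoinRoot.mk F p = AdjoinRoot.mk F (p %ₘ F) := by
      conv_lhs => rw [← AdjoinRoot.mk_leftInverse hF (AdjoinRoot.mk F p)]
      rw [AdjoinRoot.modByMonicHom_mk]
    rw [AdjoinRoot.modByMonicHom_mk]
    conv_lhs => rw [h1, (p %ₘ F).as_sum_range' (n + 1) hlt]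
    rw [map_sum, ← Finset.sum_range_reflect, Finset.sum_range]
    refine Finset.sum_congr rfl fun k _ => ?_
    rw [show n + 1 - 1 - (k : ℕ) = n - k by omega, ← C_mul_X_pow_eq_monomial]
    simp [alpha]
  have h := (S.exists_prod l i j).choose_spec
  rw [← h]
  conv_lhs => rw [key (S.exists_prod l i j).choose]
  rw [map_sum]
  refine Finset.sum_congr rfl fun k _ => ?_
  rw [map_mul, map_intCast]
  rfl

/-- `ξ = ∑ c_i βbar_{li}`. -/
def ξ (l : NarrowClassGroup F) (c : Fin (n + 1) → ℤ) : Fld F :=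
  ∑ i, (c i : Fld F) * (S.βbar l i : Fld F)

/-- `C = ∑ c_i B_{li}`. -/
def C (hF : F.Monic) (l : NarrowClassGroup F) (c : Fin (n + 1) → ℤ) :
    Matrix (Fin (n + 1)) (Fin (n + 1)) ℤ :=
  ∑ i, c i • S.B hF l i

end Choices

/-- `det C_{jd}`, the determinant of `C` with row `j` and the last column removed. -/
def minorDet {n : ℕ} (C : Matrix (Fin (n + 1)) (Fin (n + 1)) ℤ) (j : Fin (n + 1)) : ℤ :=
  (C.submatrix j.succAbove (Fin.last n).succAbove).det

/-- `∑_j (-1)^{j+d} u_j det C_{jd} = 1`; the indices `j` run from `0` here, and `d = n + 1`. -/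
def IsBezoutCol {n : ℕ} (C : Matrix (Fin (n + 1)) (Fin (n + 1)) ℤ) (u : Fin (n + 1) → ℤ) : Prop :=
  ∑ j : Fin (n + 1), (-1) ^ ((j : ℕ) + n) * u j * minorDet C j = 1

/-- The matrix that is the identity matrix apart from its last column, which is
`(-r_0, …, -r_{n-1}, m)`. -/
def cyclicMatrix {n : ℕ} (m : ℤ) (r : Fin n → ℤ) : Matrix (Fin (n + 1)) (Fin (n + 1)) ℤ :=
  Matrix.of fun i k =>
    if k = Fin.last n then (if h : i = Fin.last n then m else -r (i.castPred h))
    else if i = k then 1 else 0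

/-- `r = (r_0, …, r_{n-1})` consists of representatives of the residue classes of
`μ^{d-1}, …, μ^2, μ` modulo `m`. -/
def IsPowerReps {n : ℕ} (m μ : ℤ) (r : Fin n → ℤ) : Prop :=
  ∀ i : Fin n, r i ≡ μ ^ (n - (i : ℕ)) [ZMOD m]

/-- The ideal `J` of `ℤ[α]` corresponds to `m` and `μ (mod m)`: as a lattice it is spanned by the
entries of `(cyclic matrix of m, μ) (α^{d-1}, …, α, 1)ᵗ`. -/
def CorrespondsTo (n : ℕ) (m μ : ℤ) (J : Ideal (Order F)) : Prop :=
  (J : Set (Order F)) = (Submodule.span ℤ (Set.range fun i : Fin (n + 1) =>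
    ∑ k : Fin (n + 1), cyclicMatrix m (fun i : Fin n => μ ^ (n - (i : ℕ))) i k •
      alpha F ^ (n - (k : ℕ))) : Submodule ℤ (Order F))

namespace Choices

variable {n : ℕ} (S : Choices F n)

/-- The conditions on `l` and `c`: `ξ ∈ D`, and the minors `det C_{jd}` are coprime. -/
def Admissible (hF : F.Monic) (l : NarrowClassGroup F) (c : Fin (n + 1) → ℤ) : Prop :=
  S.ξ l c ∈ S.D ∧ Finset.univ.gcd (minorDet (S.C hF l c)) = 1

/-- The matrix obtained from `C` by replacing its last column by `u` is the inverse of a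
`γ ∈ SL(d, ℤ)` such that `γ 𝔅_l diag(ξ) = M 𝔅_1` and `M = γ C`, with `M` the matrix
`cyclicMatrix m r`. -/
def Relates (hF : F.Monic) (l : NarrowClassGroup F) (c u : Fin (n + 1) → ℤ) (m : ℤ)
    (r : Fin n → ℤ) : Prop :=
  ∃ γ : Matrix.SpecialLinearGroup (Fin (n + 1)) ℤ,
    ((γ⁻¹ : Matrix.SpecialLinearGroup (Fin (n + 1)) ℤ) : Matrix (Fin (n + 1)) (Fin (n + 1)) ℤ) =
      (S.C hF l c).updateCol (Fin.last n) u ∧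
    (γ : Matrix (Fin (n + 1)) (Fin (n + 1)) ℤ).map (Int.cast : ℤ → ℂ) * S.frakB l *
        Matrix.diagonal (fun k => S.σ k (S.ξ l c)) =
      (cyclicMatrix m r).map (Int.cast : ℤ → ℂ) * S.frakB 1 ∧
    cyclicMatrix m r = (γ : Matrix (Fin (n + 1)) (Fin (n + 1)) ℤ) * S.C hF l c

/-- `l` and `c` give rise to `m` and `μ (mod m)`: Bezout columns exist, and the relation
`Relates` is a bijection between the Bezout columns `u` and the systems `r` of representatives of
the `μ^j (mod m)`. -/
def Yields (hF : F.Monic) (l : NarrowClassGroup F) (c : Fin (n + 1) → ℤ) (m μ : ℤ) : Prop :=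
  (∃ u, IsBezoutCol (S.C hF l c) u) ∧
  (∀ u, IsBezoutCol (S.C hF l c) u → ∃! r, IsPowerReps m μ r ∧ S.Relates hF l c u m r) ∧
  (∀ r, IsPowerReps m μ r → ∃! u, IsBezoutCol (S.C hF l c) u ∧ S.Relates hF l c u m r)

end Choices

end

end

end RootParam

/-!
Let `d = n + 1`, let `a = (α^n, …, α, 1)ᵗ` and let `b` be the column of the basis `β_{lj}` of `I_l`.
By definition of the `B_{li}` one has `ξ b = C a`, so the rows of `C` are the coordinates of a
`ℤ`-basis of the ideal `ξ I_l` (`Choices.mem_ξ_mul_I_iff`). In terms of embeddings this says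
`𝔅_l diag(ξ) = C 𝔅_1`. Hence `det C` is the norm of `ξ` times `det 𝔅_l / det 𝔅_1`, which is
positive because the norm of a totally positive number is (`Choices.det_C_pos`).

A Bezout column `u` is one that makes the matrix `U`, which is `C` with last column `u`, unimodular.
Then `U⁻¹ C` agrees with the identity outside its last column, i.e. `C = U * cyclicMatrix m r` with
`m = det C`, and this identity is equivalent to the relation between `u` and `r`
(`Choices.relates_iff`). Changing `r` modulo `m` multiplies `cyclicMatrix m r` on the left by a
unipotent matrix that is the identity outside its last column, so a single such factorization
gives the bijection between Bezout columns and the admitted `r` (`Choices.yields_of_eq_mul`).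

The factorization also shows that `ξ I_l` has the basis `α^n - r_0, …, α - r_{n-1}, m`. Therefore
`ℤ[α] / ξ I_l` is `ℤ / m`; if `α` maps to the residue of `μ`, then `F(μ) ≡ 0` and
`r_i ≡ μ^{n-i}` modulo `m` (`Choices.exists_isPowerReps`).

Conversely, an invertible ideal `J` is `ξ I_l` for exactly one class `l` and one `ξ` in the
fundamental domain (`Choices.exists_spanSingleton_mul_eq`, `Choices.eq_of_spanSingleton_mul_eq`).
If `J` corresponds to `m` and `μ`, then the matrices `C` and `cyclicMatrix m (μ^n, …, μ)` span the
same lattice and have positive determinants, so they differ by a unimodular factor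
(`exists_eq_mul_of_latticeOf_eq`).
-/

namespace RootParam

/-! ### Integer matrices and the cyclic matrix -/

section Matrices

variable {n : ℕ}

@[simp] theorem cyclicMatrix_castSucc_castSucc (m : ℤ) (r : Fin n → ℤ) (i k : Fin n) :
    cyclicMatrix m r i.castSucc k.castSucc = if i = k then 1 else 0 := by
  simp [cyclicMatrix, Fin.castSucc_ne_last]

@[simp] theorem cyclicMatrix_castSucc_last (m : ℤ) (r : Fin n → ℤ) (i : Fin n) :
    cyclicMatrix m r i.castSucc (Fin.last n) = -r i := by
  simp [cyclicMatrix, Fin.castSucc_ne_last]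

@[simp] theorem cyclicMatrix_last_castSucc (m : ℤ) (r : Fin n → ℤ) (k : Fin n) :
    cyclicMatrix m r (Fin.last n) k.castSucc = 0 := by
  simp [cyclicMatrix, Fin.castSucc_ne_last, (Fin.castSucc_ne_last _).symm]

@[simp] theorem cyclicMatrix_last_last (m : ℤ) (r : Fin n → ℤ) :
    cyclicMatrix m r (Fin.last n) (Fin.last n) = m := by
  simp [cyclicMatrix]

theorem vecMul_cyclicMatrix_castSucc (w : Fin (n + 1) → ℤ) (m : ℤ) (r : Fin n → ℤ) (k : Fin n) :
    Matrix.vecMul w (cyclicMatrix m r) k.castSucc = w k.castSucc := by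
  simp [Matrix.vecMul, dotProduct, Fin.sum_univ_castSucc]

theorem vecMul_cyclicMatrix_last (w : Fin (n + 1) → ℤ) (m : ℤ) (r : Fin n → ℤ) :
    Matrix.vecMul w (cyclicMatrix m r) (Fin.last n) =
      m * w (Fin.last n) - ∑ i, r i * w i.castSucc := by
  simp only [Matrix.vecMul, dotProduct, Fin.sum_univ_castSucc, cyclicMatrix_castSucc_last,
    cyclicMatrix_last_last, mul_neg, Finset.sum_neg_distrib, mul_comm]
  ring

theorem mul_cyclicMatrix_castSucc (U : Matrix (Fin (n + 1)) (Fin (n + 1)) ℤ) (m : ℤ)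
    (r : Fin n → ℤ) (j : Fin (n + 1)) (k : Fin n) :
    (U * cyclicMatrix m r) j k.castSucc = U j k.castSucc :=
  vecMul_cyclicMatrix_castSucc (U j) m r k

theorem mul_cyclicMatrix_last (U : Matrix (Fin (n + 1)) (Fin (n + 1)) ℤ) (m : ℤ)
    (r : Fin n → ℤ) (j : Fin (n + 1)) :
    (U * cyclicMatrix m r) j (Fin.last n) =
      m * U j (Fin.last n) - ∑ i, r i * U j i.castSucc :=
  vecMul_cyclicMatrix_last (U j) m r

theorem det_cyclicMatrix (m : ℤ) (r : Fin n → ℤ) : (cyclicMatrix m r).det = m := by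
  rw [Matrix.det_of_isUpperTriangular, Fin.prod_univ_castSucc]
  · simp
  · intro i j hij
    induction j using Fin.lastCases with
    | last => exact absurd hij (not_lt.mpr (Fin.le_last i))
    | cast j =>
      induction i using Fin.lastCases with
      | last => simp
      | cast i =>
        have : j ≠ i := ne_of_lt (by simpa using hij)
        simp [this.symm]

theorem cyclicMatrix_one_mul (m : ℤ) (e r : Fin n → ℤ) :
    cyclicMatrix 1 e * cyclicMatrix m r = cyclicMatrix m (fun i => m * e i + r i) := by
  ext i k
  induction k using Fin.lastCases with
  | last =>
    rw [mul_cyclicMatrix_last]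
    induction i using Fin.lastCases with
    | last => simp
    | cast i => simp; ring
  | cast k =>
    rw [mul_cyclicMatrix_castSucc]
    induction i using Fin.lastCases with
    | last => simp
    | cast i => simp

/-- Changing the `r i` modulo `m` multiplies the cyclic matrix by a unimodular one. -/
theorem exists_mul_cyclicMatrix_of_modEq {m : ℤ} {r s : Fin n → ℤ}
    (h : ∀ i, r i ≡ s i [ZMOD m]) :
    ∃ E : Matrix (Fin (n + 1)) (Fin (n + 1)) ℤ, E.det = 1 ∧
      cyclicMatrix m s = E * cyclicMatrix m r := by
  choose e he using fun i => (h i).dvd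
  refine ⟨cyclicMatrix 1 e, det_cyclicMatrix _ _, ?_⟩
  rw [cyclicMatrix_one_mul]
  congr 1
  funext i
  rw [← he i]
  ring

/-- The Bezout relation is the expansion of a determinant along the last column. -/
theorem isBezoutCol_iff {C : Matrix (Fin (n + 1)) (Fin (n + 1)) ℤ} {u : Fin (n + 1) → ℤ} :
    IsBezoutCol C u ↔ (C.updateCol (Fin.last n) u).det = 1 := by
  rw [Matrix.det_succ_column _ (Fin.last n), IsBezoutCol]
  simp only [minorDet, Matrix.updateCol_self, Fin.val_last, Matrix.submatrix_updateCol_succAbove]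

theorem exists_isBezoutCol {C : Matrix (Fin (n + 1)) (Fin (n + 1)) ℤ}
    (h : Finset.univ.gcd (minorDet C) = 1) : ∃ u, IsBezoutCol C u := by
  obtain ⟨v, hv⟩ := Finset.gcd_eq_sum_mul Finset.univ (minorDet C)
  refine ⟨fun j => (-1) ^ ((j : ℕ) + n) * v j, ?_⟩
  refine Eq.trans ?_ (hv.symm.trans h)
  refine Finset.sum_congr rfl fun j _ => ?_
  rw [← mul_assoc ((-1 : ℤ) ^ _), ← mul_pow, neg_one_mul, neg_neg, one_pow, one_mul, mul_comm]

theorem IsBezoutCol.gcd_minorDet {C : Matrix (Fin (n + 1)) (Fin (n + 1)) ℤ}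
    {u : Fin (n + 1) → ℤ} (h : IsBezoutCol C u) : Finset.univ.gcd (minorDet C) = 1 := by
  have h1 : Finset.univ.gcd (minorDet C) ∣ 1 := by
    rw [← h]
    exact Finset.dvd_sum fun j hj => (Finset.gcd_dvd hj).mul_left _
  rw [← Finset.normalize_gcd]
  exact normalize_eq_one.mpr (isUnit_of_dvd_one h1)

/-- A factor `U` of `U * cyclicMatrix m r` is recovered by restoring its last column. -/
theorem updateCol_mul_cyclicMatrix (U : Matrix (Fin (n + 1)) (Fin (n + 1)) ℤ) (m : ℤ)
    (r : Fin n → ℤ) :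
    (U * cyclicMatrix m r).updateCol (Fin.last n) (fun j => U j (Fin.last n)) = U := by
  ext j k
  induction k using Fin.lastCases with
  | last => simp
  | cast k => simp [mul_cyclicMatrix_castSucc]

/-- A matrix that becomes unimodular when its last column is replaced factors through a cyclic
matrix: after multiplication by the inverse of the unimodular one, all columns but the last are
those of the identity. -/
theorem IsBezoutCol.exists_eq_mul_cyclicMatrix {C : Matrix (Fin (n + 1)) (Fin (n + 1)) ℤ}
    {u : Fin (n + 1) → ℤ} (h : IsBezoutCol C u) :
    ∃ r : Fin n → ℤ, C = C.updateCol (Fin.last n) u * cyclicMatrix C.det r := by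
  have hdet := isBezoutCol_iff.mp h
  set U := C.updateCol (Fin.last n) u with hU
  have hUu : IsUnit U.det := by rw [hdet]; exact isUnit_one
  set N := U⁻¹ * C with hN
  have hCN : C = U * N := by rw [hN, Matrix.mul_nonsing_inv_cancel_left _ _ hUu]
  have hcol : ∀ i (k : Fin n), N i k.castSucc = (1 : Matrix _ _ ℤ) i k.castSucc := by
    intro i k
    rw [← Matrix.nonsing_inv_mul _ hUu, hN, Matrix.mul_apply, Matrix.mul_apply]
    simp [hU]
  have hNc : N =
      cyclicMatrix (N (Fin.last n) (Fin.last n)) (fun i => -N i.castSucc (Fin.last n)) := by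
    ext i k
    induction k using Fin.lastCases with
    | last => induction i using Fin.lastCases <;> simp
    | cast k =>
      rw [hcol]
      induction i using Fin.lastCases with
      | last => simp [(Fin.castSucc_ne_last k).symm]
      | cast i => simp [Matrix.one_apply]
  have hm : N (Fin.last n) (Fin.last n) = C.det := by
    conv_rhs => rw [hCN, Matrix.det_mul, hdet, one_mul, hNc, det_cyclicMatrix]
  refine ⟨fun i => -N i.castSucc (Fin.last n), ?_⟩
  rw [← hm, ← hNc, ← hCN]

/-- With `W = U⁻¹ V` the hypothesis reads `cyclicMatrix m r = W * cyclicMatrix m s`. The first `n`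
columns of `W` are then those of the identity, and the last column gives the congruence. -/
theorem modEq_of_mul_cyclicMatrix_eq {U V : Matrix (Fin (n + 1)) (Fin (n + 1)) ℤ} {m : ℤ}
    {r s : Fin n → ℤ} (hU : U.det = 1) (h : U * cyclicMatrix m r = V * cyclicMatrix m s)
    (i : Fin n) : r i ≡ s i [ZMOD m] := by
  have hUu : IsUnit U.det := by rw [hU]; exact isUnit_one
  have h1 : cyclicMatrix m r = U⁻¹ * V * cyclicMatrix m s := by
    rw [Matrix.mul_assoc, ← h, Matrix.nonsing_inv_mul_cancel_left _ _ hUu]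
  have hcol : ∀ k : Fin n, (U⁻¹ * V) i.castSucc k.castSucc = if i = k then 1 else 0 := by
    intro k
    rw [← mul_cyclicMatrix_castSucc (U⁻¹ * V) m s, ← h1, cyclicMatrix_castSucc_castSucc]
  have h2 := congrFun (congrFun h1 i.castSucc) (Fin.last n)
  rw [mul_cyclicMatrix_last, cyclicMatrix_castSucc_last] at h2
  simp only [hcol, mul_ite, mul_one, mul_zero, Finset.sum_ite_eq, Finset.mem_univ, if_true] at h2
  refine Int.modEq_iff_dvd.mpr ⟨(U⁻¹ * V) i.castSucc (Fin.last n), ?_⟩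
  linarith

theorem cyclicMatrix_right_injective (m : ℤ) :
    Function.Injective (cyclicMatrix (n := n) m) := fun r s h => by
  funext i
  simpa using congrFun (congrFun h i.castSucc) (Fin.last n)

theorem mul_left_injective_of_det_ne_zero {M : Matrix (Fin (n + 1)) (Fin (n + 1)) ℤ}
    (hM : M.det ≠ 0) : Function.Injective fun U : Matrix (Fin (n + 1)) (Fin (n + 1)) ℤ => U * M :=
  fun U V h => by
    have h1 : U * M * M.adjugate = V * M * M.adjugate := by rw [show U * M = V * M from h]
    simp only [Matrix.mul_assoc, Matrix.mul_adjugate, Matrix.mul_smul, Matrix.mul_one] at h1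
    exact smul_right_injective _ hM h1

end Matrices

/-! ### Positivity of the norm of a totally positive number -/

section Embeddings

variable {F : ℤ[X]}

theorem ringHom_ext_alpha {R : Type*} [CommRing R] {φ ψ : Fld F →+* R}
    (h : φ (algebraMap (Order F) (Fld F) (alpha F)) = ψ (algebraMap (Order F) (Fld F) (alpha F))) :
    φ = ψ := by
  refine IsLocalization.ringHom_ext (Order F)⁰ (Ideal.Quotient.ringHom_ext ?_)
  refine Polynomial.ringHom_ext' (RingHom.ext_int _ _) ?_
  exact h

/-- An embedding that is real at `α` equals its complex conjugate. -/
theorem map_im_eq_zero {φ : Fld F →+* ℂ}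
    (h : (φ (algebraMap (Order F) (Fld F) (alpha F))).im = 0) (x : Fld F) : (φ x).im = 0 := by
  have h1 : (starRingEnd ℂ).comp φ = φ :=
    ringHom_ext_alpha (Complex.conj_eq_iff_im.mpr h)
  exact Complex.conj_eq_iff_im.mp (congrArg (fun ψ : Fld F →+* ℂ => ψ x) h1)

theorem TotPos.map_re_pos_and_im_eq_zero {x : Fld F} (hx : TotPos x) {φ : Fld F →+* ℂ}
    (h : (φ (algebraMap (Order F) (Fld F) (alpha F))).im = 0) : 0 < (φ x).re ∧ (φ x).im = 0 := by
  have him := map_im_eq_zero h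
  let ψ : Fld F →+* ℝ :=
    { toFun := fun y => (φ y).re
      map_one' := by simp
      map_zero' := by simp
      map_mul' := fun a b => by simp [him]
      map_add' := fun a b => by simp }
  exact ⟨hx ψ, him x⟩

variable [Fact (Irreducible F)]

/-- The norm of a nonzero totally positive element is positive: the real embeddings contribute
positive factors and the non-real ones pair up to squares of absolute values. -/
theorem TotPos.exists_prod_eq {ι : Type*} [Fintype ι] (σ : ι ≃ (Fld F →+* ℂ)) {x : Fld F}
    (hx : TotPos x) (h0 : x ≠ 0) : ∃ t : ℝ, 0 < t ∧ ∏ k, σ k x = t := by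
  classical
  set θ := algebraMap (Order F) (Fld F) (alpha F)
  let c : ι → ι := fun k => σ.symm ((starRingEnd ℂ).comp (σ k))
  have hc : ∀ k y, σ (c k) y = starRingEnd ℂ (σ k y) := fun k y => by simp [c]
  have hcc : ∀ k, c (c k) = k := fun k => by
    apply σ.injective
    ext y
    simp [hc]
  have hreal : ∃ t : ℝ, 0 < t ∧ ∏ k with (σ k θ).im = 0, σ k x = t := by
    refine ⟨∏ k with (σ k θ).im = 0, (σ k x).re, Finset.prod_pos fun k hk => ?_, ?_⟩
    · exact (hx.map_re_pos_and_im_eq_zero (Finset.mem_filter.mp hk).2).1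
    · rw [Complex.ofReal_prod]
      refine Finset.prod_congr rfl fun k hk => Complex.ext rfl ?_
      simpa using (hx.map_re_pos_and_im_eq_zero (Finset.mem_filter.mp hk).2).2
  have hneg : ∏ k with (σ k θ).im < 0, σ k x = starRingEnd ℂ (∏ k with 0 < (σ k θ).im, σ k x) := by
    rw [map_prod]
    refine Finset.prod_nbij' c c ?_ ?_ (fun k _ => hcc k) (fun k _ => hcc k) ?_
    · intro k hk
      simpa [hc] using hk
    · intro k hk
      simpa [hc] using hk
    · intro k _
      rw [hc, Complex.conj_conj]
  obtain ⟨t, ht, hreal⟩ := hreal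
  set z := ∏ k with 0 < (σ k θ).im, σ k x with hz
  have hz0 : z ≠ 0 := Finset.prod_ne_zero_iff.mpr fun k _ => (map_ne_zero (σ k)).mpr h0
  refine ⟨t * Complex.normSq z, mul_pos ht (Complex.normSq_pos.mpr hz0), ?_⟩
  have h1 := Finset.prod_filter_mul_prod_filter_not Finset.univ
    (fun k => (σ k θ).im = 0) (fun k => σ k x)
  have h2 := Finset.prod_filter_mul_prod_filter_not
    (Finset.univ.filter fun k => ¬ (σ k θ).im = 0) (fun k => 0 < (σ k θ).im) (fun k => σ k x)
  rw [Finset.filter_filter, Finset.filter_filter] at h2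
  have e1 : (Finset.univ.filter fun k => ¬ (σ k θ).im = 0 ∧ 0 < (σ k θ).im) =
      Finset.univ.filter fun k => 0 < (σ k θ).im :=
    Finset.filter_congr fun k _ => ⟨fun h => h.2, fun h => ⟨h.ne', h⟩⟩
  have e2 : (Finset.univ.filter fun k => ¬ (σ k θ).im = 0 ∧ ¬ 0 < (σ k θ).im) =
      Finset.univ.filter fun k => (σ k θ).im < 0 :=
    Finset.filter_congr fun k _ =>
      ⟨fun h => lt_of_le_of_ne (not_lt.mp h.2) h.1, fun h => ⟨h.ne, h.not_gt⟩⟩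
  rw [e1, e2, hneg, ← hz, Complex.mul_conj] at h2
  rw [← h1, ← h2, hreal, Complex.ofReal_mul]

end Embeddings

/-! ### The matrix `C` -/

namespace Choices

variable {F : ℤ[X]} [Fact (Irreducible F)] {n : ℕ} (S : Choices F n)

/-- `𝔅_1` is a Vandermonde matrix with its rows reversed. -/
theorem det_frakB_one_ne_zero : (S.frakB 1).det ≠ 0 := by
  have h1 : S.frakB 1 = (Matrix.vandermonde fun k =>
      S.σ k (algebraMap (Order F) (Fld F) (alpha F))).transpose.submatrix Fin.revPerm id := by
    ext j k
    simp only [frakB, embMatrix, Matrix.of_apply, S.β_one, map_pow, Matrix.submatrix_apply,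
      Matrix.transpose_apply, Matrix.vandermonde_apply, Fin.revPerm_apply, id, Fin.val_rev]
    congr 1
    omega
  rw [h1, Matrix.det_permute, Matrix.det_transpose]
  refine mul_ne_zero (by exact_mod_cast (Equiv.Perm.sign _).isUnit.ne_zero)
    (Matrix.det_vandermonde_ne_zero_iff.mpr fun j k h => S.σ.injective (ringHom_ext_alpha h))

variable (hF : F.Monic)

theorem C_apply (l : NarrowClassGroup F) (c : Fin (n + 1) → ℤ) (j k : Fin (n + 1)) :
    S.C hF l c j k = ∑ i, c i * S.B hF l i j k := by
  simp only [C, Matrix.sum_apply, Matrix.smul_apply, smul_eq_mul]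

theorem ξ_mul_β (hn : F.natDegree = n + 1) (l : NarrowClassGroup F) (c : Fin (n + 1) → ℤ)
    (j : Fin (n + 1)) :
    S.ξ l c * algebraMap (Order F) (Fld F) (S.β l j) =
      ∑ k : Fin (n + 1),
        (S.C hF l c j k : Fld F) * algebraMap (Order F) (Fld F) (alpha F ^ (n - (k : ℕ))) := by
  simp only [ξ, Finset.sum_mul, C_apply, Int.cast_sum, Int.cast_mul]
  rw [Finset.sum_comm]
  refine Finset.sum_congr rfl fun i _ => ?_
  rw [mul_assoc, S.B_spec hF hn, Finset.mul_sum]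
  exact Finset.sum_congr rfl fun k _ => (mul_assoc _ _ _).symm

theorem frakB_mul_diagonal (hn : F.natDegree = n + 1) (l : NarrowClassGroup F)
    (c : Fin (n + 1) → ℤ) :
    S.frakB l * Matrix.diagonal (fun k => S.σ k (S.ξ l c)) =
      (S.C hF l c).map (Int.cast : ℤ → ℂ) * S.frakB 1 := by
  ext j k
  rw [Matrix.mul_diagonal, Matrix.mul_apply]
  simp only [frakB, embMatrix, Matrix.of_apply, Matrix.map_apply, S.β_one]
  rw [mul_comm, ← map_mul, S.ξ_mul_β hF hn, map_sum]
  simp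

/-- `det C` is the norm of `ξ` times the positive ratio `det 𝔅_l / det 𝔅_1`. -/
theorem det_C_pos (hn : F.natDegree = n + 1) {l : NarrowClassGroup F} {c : Fin (n + 1) → ℤ}
    (hξ : TotPos (S.ξ l c)) (h0 : S.ξ l c ≠ 0) : 0 < (S.C hF l c).det := by
  obtain ⟨t, ht, hN⟩ := hξ.exists_prod_eq S.σ h0
  obtain ⟨s, hs, hB⟩ := S.sign_det l
  have h1 := congrArg Matrix.det (S.frakB_mul_diagonal hF hn l c)
  rw [Matrix.det_mul, Matrix.det_mul, Matrix.det_diagonal, hN, frakB, hB, ← frakB,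
    ← Int.cast_det] at h1
  have h2 : (((S.C hF l c).det : ℝ) : ℂ) = ((s * t : ℝ) : ℂ) := by
    refine mul_right_cancel₀ S.det_frakB_one_ne_zero ?_
    rw [Complex.ofReal_intCast, ← h1, Complex.ofReal_mul]
    ring
  have h3 := Complex.ofReal_injective h2
  exact_mod_cast h3 ▸ mul_pos hs ht

theorem ξ_injective (l : NarrowClassGroup F) : Function.Injective (S.ξ l) := by
  intro c c' h
  have h1 : ∑ i, c i • S.βbar l i = ∑ i, c' i • S.βbar l i := by
    apply Subtype.ext
    simpa [ξ, zsmul_eq_mul] using h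
  exact (S.βbar l).linearIndependent.fintypeLinearCombination_injective h1

/-- A totally positive element may vanish only if there are no real embeddings; coprimality of the
minors then rules it out. -/
theorem Admissible.ξ_ne_zero {l : NarrowClassGroup F} {c : Fin (n + 1) → ℤ}
    (h : S.Admissible hF l c) : S.ξ l c ≠ 0 := by
  intro h0
  have hc : c = 0 := S.ξ_injective l (h0.trans (by simp [ξ]))
  have hC : S.C hF l c = 0 := by simp [C, hc]
  rcases n with _ | n
  · -- in degree one the only embedding is real
    have hconj : (starRingEnd ℂ).comp (S.σ 0) = S.σ 0 :=
      S.σ.symm.injective (Subsingleton.elim (α := Fin 1) _ _)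
    have hpos := ((S.isFundDomain.totPos _ h.1).map_re_pos_and_im_eq_zero (φ := S.σ 0)
      (Complex.conj_eq_iff_im.mp (congrArg (fun ψ : Fld F →+* ℂ => ψ _) hconj))).1
    simp [h0] at hpos
  · obtain ⟨u, hu⟩ := exists_isBezoutCol h.2
    simp [IsBezoutCol, minorDet, hC] at hu

end Choices

/-! ### Lattices given by integer matrices -/

section Lattice

variable (F : ℤ[X])

/-- The integer combination of `α^n, …, α, 1` with coefficients `w`, as an element of `ℚ(α)`. -/
noncomputable def ofCoords (n : ℕ) : (Fin (n + 1) → ℤ) →ₗ[ℤ] Fld F :=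
  Fintype.linearCombination ℤ fun k : Fin (n + 1) =>
    algebraMap (Order F) (Fld F) (alpha F ^ (n - (k : ℕ)))

variable {n : ℕ}

theorem ofCoords_apply (w : Fin (n + 1) → ℤ) :
    ofCoords F n w =
      ∑ k, (w k : Fld F) * algebraMap (Order F) (Fld F) (alpha F ^ (n - (k : ℕ))) := by
  simp only [ofCoords, Fintype.linearCombination_apply, zsmul_eq_mul]

/-- The lattice in `ℚ(α)` spanned by the entries of `A (α^n, …, α, 1)ᵗ`. -/
noncomputable def latticeOf (A : Matrix (Fin (n + 1)) (Fin (n + 1)) ℤ) : Submodule ℤ (Fld F) :=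
  LinearMap.range (ofCoords F n ∘ₗ A.vecMulLinear)

variable {F}

theorem mem_latticeOf {A : Matrix (Fin (n + 1)) (Fin (n + 1)) ℤ} {y : Fld F} :
    y ∈ latticeOf F A ↔ ∃ v, ofCoords F n (Matrix.vecMul v A) = y := Iff.rfl

theorem ofCoords_row_mem_latticeOf (A : Matrix (Fin (n + 1)) (Fin (n + 1)) ℤ) (i : Fin (n + 1)) :
    ofCoords F n (A i) ∈ latticeOf F A :=
  ⟨Pi.single i 1, congrArg (ofCoords F n) (Matrix.single_one_vecMul i A)⟩

theorem latticeOf_mul_le (U A : Matrix (Fin (n + 1)) (Fin (n + 1)) ℤ) :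
    latticeOf F (U * A) ≤ latticeOf F A := by
  rintro _ ⟨v, rfl⟩
  exact ⟨Matrix.vecMul v U, by simp [Matrix.vecMul_vecMul]⟩

theorem latticeOf_mul_of_det_eq_one {U : Matrix (Fin (n + 1)) (Fin (n + 1)) ℤ} (hU : U.det = 1)
    (A : Matrix (Fin (n + 1)) (Fin (n + 1)) ℤ) : latticeOf F (U * A) = latticeOf F A := by
  refine le_antisymm (latticeOf_mul_le U A) ?_
  have hUu : IsUnit U.det := by rw [hU]; exact isUnit_one
  conv_lhs => rw [← Matrix.nonsing_inv_mul_cancel_left U A hUu]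
  exact latticeOf_mul_le _ _

theorem exists_eq_mul_of_latticeOf_le (hinj : Function.Injective (ofCoords F n))
    {A B : Matrix (Fin (n + 1)) (Fin (n + 1)) ℤ} (h : latticeOf F A ≤ latticeOf F B) :
    ∃ P, A = P * B := by
  choose P hP using fun i => h (ofCoords_row_mem_latticeOf A i)
  refine ⟨Matrix.of P, ?_⟩
  ext i k
  exact (congrFun (hinj (hP i)) k).symm

/-- Two integer matrices of positive determinant that span the same lattice differ by a left factor
of determinant one: the determinants of the two transition matrices are positive and mutually
inverse integers. -/
theorem exists_eq_mul_of_latticeOf_eq (hinj : Function.Injective (ofCoords F n))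
    {A B : Matrix (Fin (n + 1)) (Fin (n + 1)) ℤ} (h : latticeOf F A = latticeOf F B)
    (hA : 0 < A.det) (hB : 0 < B.det) : ∃ P : Matrix _ _ ℤ, P.det = 1 ∧ A = P * B := by
  obtain ⟨P, hP⟩ := exists_eq_mul_of_latticeOf_le hinj h.le
  obtain ⟨Q, hQ⟩ := exists_eq_mul_of_latticeOf_le hinj h.ge
  refine ⟨P, ?_, hP⟩
  have h1 : A.det = P.det * B.det := by rw [← Matrix.det_mul, ← hP]
  have h2 : B.det = Q.det * A.det := by rw [← Matrix.det_mul, ← hQ]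
  have hPpos : 0 < P.det := pos_of_mul_pos_left (h1 ▸ hA) hB.le
  refine Int.eq_one_of_mul_eq_one_right hPpos.le (b := Q.det) ?_
  refine mul_right_cancel₀ hB.ne' ?_
  rw [one_mul, mul_assoc, mul_comm, mul_assoc, mul_comm _ P.det, ← h1, ← h2]

/-- The ideal corresponding to `m` and `μ`, viewed in `ℚ(α)`. -/
theorem CorrespondsTo.mem_coeIdeal_iff {m μ : ℤ} {J : Ideal (Order F)} (h : CorrespondsTo n m μ J)
    {y : Fld F} : y ∈ (J : FractionalIdeal (Order F)⁰ (Fld F)) ↔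
      y ∈ latticeOf F (cyclicMatrix m fun i : Fin n => μ ^ (n - (i : ℕ))) := by
  have hmem : ∀ x : Order F, x ∈ J ↔ _ := fun x => Set.ext_iff.mp h x
  rw [FractionalIdeal.mem_coeIdeal, mem_latticeOf]
  set M := cyclicMatrix m fun i : Fin n => μ ^ (n - (i : ℕ))
  have hsum : ∀ v : Fin (n + 1) → ℤ, ofCoords F n (Matrix.vecMul v M) =
      algebraMap (Order F) (Fld F)
        (∑ i, v i • ∑ k : Fin (n + 1), M i k • alpha F ^ (n - (k : ℕ))) := by
    intro v
    simp only [ofCoords_apply, Matrix.vecMul, dotProduct, Finset.smul_sum, map_sum,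
      Int.cast_sum, Finset.sum_mul, zsmul_eq_mul, map_mul, map_intCast]
    rw [Finset.sum_comm]
    simp only [Int.cast_mul, mul_assoc]
  constructor
  · rintro ⟨x, hx, rfl⟩
    obtain ⟨v, rfl⟩ := (Submodule.mem_span_range_iff_exists_fun ℤ).mp ((hmem x).mp hx)
    exact ⟨v, hsum v⟩
  · rintro ⟨v, rfl⟩
    exact ⟨_, (hmem _).mpr ((Submodule.mem_span_range_iff_exists_fun ℤ).mpr ⟨v, rfl⟩),
      (hsum v).symm⟩

end Lattice

namespace Choices

variable {F : ℤ[X]} [Fact (Irreducible F)] {n : ℕ} (S : Choices F n)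

theorem ofCoords_injective (S : Choices F n) : Function.Injective (ofCoords F n) := by
  intro v w h
  refine (S.β 1).linearIndependent.fintypeLinearCombination_injective (Subtype.ext ?_)
  apply IsFractionRing.injective (Order F) (Fld F)
  rw [ofCoords_apply, ofCoords_apply] at h
  simpa [Fintype.linearCombination_apply, S.β_one] using h

theorem exists_ofCoords_eq (S : Choices F n) (x : Order F) :
    ∃ v, ofCoords F n v = algebraMap (Order F) (Fld F) x := by
  have hx : x ∈ S.I 1 := by rw [S.I_one]; trivial
  refine ⟨(S.β 1).repr ⟨x, hx⟩, ?_⟩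
  have h := congrArg (fun y : S.I 1 => algebraMap (Order F) (Fld F) y)
    ((S.β 1).sum_repr ⟨x, hx⟩)
  rw [ofCoords_apply]
  refine Eq.trans ?_ h
  rw [Submodule.coe_sum, map_sum]
  refine Finset.sum_congr rfl fun k _ => ?_
  rw [Submodule.coe_smul_of_tower, map_zsmul, zsmul_eq_mul, S.β_one]

variable (hF : F.Monic)

/-- The fractional ideal `ξ I_l` has the lattice basis `C (α^n, …, α, 1)ᵗ`. -/
theorem mem_ξ_mul_I_iff (hn : F.natDegree = n + 1) (l : NarrowClassGroup F)
    (c : Fin (n + 1) → ℤ) {y : Fld F} :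
    y ∈ FractionalIdeal.spanSingleton (Order F)⁰ (S.ξ l c) *
        (S.I l : FractionalIdeal (Order F)⁰ (Fld F)) ↔ y ∈ latticeOf F (S.C hF l c) := by
  have hsum : ∀ v : Fin (n + 1) → ℤ, ofCoords F n (Matrix.vecMul v (S.C hF l c)) =
      S.ξ l c * algebraMap (Order F) (Fld F) (∑ j, v j • S.β l j : S.I l) := by
    intro v
    simp only [ofCoords_apply, Matrix.vecMul, dotProduct, Int.cast_sum, Finset.sum_mul]
    rw [Finset.sum_comm, Submodule.coe_sum, map_sum, Finset.mul_sum]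
    refine Finset.sum_congr rfl fun j _ => ?_
    rw [Submodule.coe_smul_of_tower, map_zsmul, zsmul_eq_mul, mul_left_comm, S.ξ_mul_β hF hn,
      Finset.mul_sum]
    exact Finset.sum_congr rfl fun k _ => by rw [Int.cast_mul, mul_assoc]
  rw [FractionalIdeal.mem_singleton_mul, mem_latticeOf]
  constructor
  · rintro ⟨_, hz, rfl⟩
    obtain ⟨x, hx, rfl⟩ := (FractionalIdeal.mem_coeIdeal _).mp hz
    exact ⟨(S.β l).repr ⟨x, hx⟩, by rw [hsum, (S.β l).sum_repr]⟩
  · rintro ⟨v, rfl⟩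
    exact ⟨_, (FractionalIdeal.mem_coeIdeal _).mpr ⟨_, Subtype.mem _, rfl⟩, hsum v⟩

/-! ### The relation between Bezout columns and representatives of the powers of `μ` -/

/-- The relation between the embedding matrices is automatic, because `ξ b = C a` for the basis `b`
of `I_l` and `a = (α^n, …, 1)ᵗ`; what remains is `C = γ⁻¹ * cyclicMatrix m r`. -/
theorem relates_iff (hn : F.natDegree = n + 1) {l : NarrowClassGroup F} {c u : Fin (n + 1) → ℤ}
    (hu : IsBezoutCol (S.C hF l c) u) {m : ℤ} {r : Fin n → ℤ} :
    S.Relates hF l c u m r ↔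
      S.C hF l c = (S.C hF l c).updateCol (Fin.last n) u * cyclicMatrix m r := by
  constructor
  · rintro ⟨γ, h1, -, h3⟩
    rw [← h1, h3, ← Matrix.mul_assoc, ← Matrix.SpecialLinearGroup.coe_mul, inv_mul_cancel,
      Matrix.SpecialLinearGroup.coe_one, Matrix.one_mul]
  · intro h
    set U : Matrix.SpecialLinearGroup (Fin (n + 1)) ℤ := ⟨_, isBezoutCol_iff.mp hu⟩ with hU
    have h3 : cyclicMatrix m r = ((U⁻¹ : Matrix.SpecialLinearGroup (Fin (n + 1)) ℤ) :
        Matrix (Fin (n + 1)) (Fin (n + 1)) ℤ) * S.C hF l c := by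
      conv_rhs => rw [h]
      rw [← Matrix.mul_assoc]
      change _ = ((U⁻¹ : Matrix.SpecialLinearGroup (Fin (n + 1)) ℤ) :
        Matrix (Fin (n + 1)) (Fin (n + 1)) ℤ) * (U : Matrix (Fin (n + 1)) (Fin (n + 1)) ℤ) * _
      rw [← Matrix.SpecialLinearGroup.coe_mul, inv_mul_cancel,
        Matrix.SpecialLinearGroup.coe_one, Matrix.one_mul]
    refine ⟨U⁻¹, by rw [inv_inv], ?_, h3⟩
    rw [Matrix.mul_assoc, S.frakB_mul_diagonal hF hn, ← Matrix.mul_assoc, h3]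
    congr 1
    exact (Matrix.map_mul (f := Int.castRingHom ℂ)).symm

/-- One factorization `C = U * cyclicMatrix m r` with `r` representing the powers of `μ` suffices:
all others differ from it by a unipotent matrix that changes only the last column. -/
theorem yields_of_eq_mul (hn : F.natDegree = n + 1) {l : NarrowClassGroup F}
    {c : Fin (n + 1) → ℤ} {m μ : ℤ} (hm : 0 < m)
    {U : Matrix (Fin (n + 1)) (Fin (n + 1)) ℤ} (hU : U.det = 1) {r : Fin n → ℤ}
    (hr : IsPowerReps m μ r) (h : S.C hF l c = U * cyclicMatrix m r) : S.Yields hF l c m μ := by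
  have hdet : (S.C hF l c).det = m := by rw [h, Matrix.det_mul, hU, one_mul, det_cyclicMatrix]
  -- a unimodular factor of `C` is `C` with its last column replaced by a Bezout column
  have key : ∀ (V : Matrix (Fin (n + 1)) (Fin (n + 1)) ℤ) (s : Fin n → ℤ), V.det = 1 →
      S.C hF l c = V * cyclicMatrix m s →
        (S.C hF l c).updateCol (Fin.last n) (fun j => V j (Fin.last n)) = V ∧
        IsBezoutCol (S.C hF l c) fun j => V j (Fin.last n) := by
    intro V s hV hs
    have h1 : (S.C hF l c).updateCol (Fin.last n) (fun j => V j (Fin.last n)) = V := by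
      rw [hs, updateCol_mul_cyclicMatrix]
    exact ⟨h1, isBezoutCol_iff.mpr (h1.symm ▸ hV)⟩
  refine ⟨⟨_, (key U r hU h).2⟩, fun u hu => ?_, fun s hs => ?_⟩
  · obtain ⟨s, hs⟩ := hu.exists_eq_mul_cyclicMatrix
    rw [hdet] at hs
    have hdu := isBezoutCol_iff.mp hu
    refine ⟨s, ⟨fun i => ?_, (S.relates_iff hF hn hu).mpr hs⟩, ?_⟩
    · exact (modEq_of_mul_cyclicMatrix_eq hdu (hs.symm.trans h) i).trans (hr i)
    · rintro s' ⟨-, hs'⟩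
      have hss := hs.symm.trans ((S.relates_iff hF hn hu).mp hs')
      have hUu : IsUnit ((S.C hF l c).updateCol (Fin.last n) u).det := by
        rw [hdu]; exact isUnit_one
      refine cyclicMatrix_right_injective m ?_
      rw [← Matrix.nonsing_inv_mul_cancel_left _ (cyclicMatrix m s') hUu, ← hss,
        Matrix.nonsing_inv_mul_cancel_left _ _ hUu]
  · obtain ⟨E, hE, hEs⟩ := exists_mul_cyclicMatrix_of_modEq fun i => (hs i).trans (hr i).symm
    have hC : S.C hF l c = U * E * cyclicMatrix m s := by rw [Matrix.mul_assoc, ← hEs, h]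
    obtain ⟨h1, h2⟩ := key (U * E) s (by rw [Matrix.det_mul, hU, hE, one_mul]) hC
    refine ⟨_, ⟨h2, (S.relates_iff hF hn h2).mpr (by rw [h1]; exact hC)⟩, ?_⟩
    rintro u ⟨hu, hus⟩
    rw [S.relates_iff hF hn hu] at hus
    have h3 : (S.C hF l c).updateCol (Fin.last n) u = U * E :=
      mul_left_injective_of_det_ne_zero (M := cyclicMatrix m s)
        (by rw [det_cyclicMatrix]; exact hm.ne') (hus.symm.trans hC)
    funext j
    simpa using congrFun (congrFun h3 j) (Fin.last n)

end Choices

namespace Choices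

variable {F : ℤ[X]} [Fact (Irreducible F)] {n : ℕ}

/-! ### The residue of `α` modulo `ξ I_l` -/

/-- If the rows of a cyclic matrix span an ideal `J`, then `ℤ[α] / J` is `ℤ / m`: the residue of
`α` is that of an integer `μ`, which is then a root of `F` modulo `m`. -/
theorem exists_isPowerReps (S : Choices F n) {J : Ideal (Order F)} {m : ℤ} {r : Fin n → ℤ}
    (hJ : ∀ x, x ∈ J ↔ algebraMap (Order F) (Fld F) x ∈ latticeOf F (cyclicMatrix m r)) :
    ∃ μ : ℤ, F.eval μ ≡ 0 [ZMOD m] ∧ IsPowerReps m μ r := by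
  have hlast : ∀ w : Fin (n + 1) → ℤ, ofCoords F n w =
      ∑ k : Fin n, (w k.castSucc : Fld F) *
        algebraMap (Order F) (Fld F) (alpha F ^ (n - (k : ℕ))) + w (Fin.last n) := by
    intro w
    simp [ofCoords_apply, Fin.sum_univ_castSucc]
  -- `J ∩ ℤ ⊆ m ℤ`: a combination of the rows with vanishing first `n` coordinates involves only
  -- the last row
  have hint : ∀ z : ℤ, (z : Order F ⧸ J) = 0 → m ∣ z := by
    intro z hz
    rw [← map_intCast (Ideal.Quotient.mk J), Ideal.Quotient.eq_zero_iff_mem, hJ,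
      mem_latticeOf] at hz
    obtain ⟨v, hv⟩ := hz
    have h1 : Matrix.vecMul v (cyclicMatrix m r) = Pi.single (Fin.last n) z := by
      refine S.ofCoords_injective (hv.trans ?_)
      simp [hlast, Fin.castSucc_ne_last]
    have h2 : ∀ k : Fin n, v k.castSucc = 0 := fun k => by
      rw [← vecMul_cyclicMatrix_castSucc v m r, h1]
      simp [Fin.castSucc_ne_last]
    have h3 := congrFun h1 (Fin.last n)
    rw [vecMul_cyclicMatrix_last] at h3
    simp only [h2, mul_zero, Finset.sum_const_zero, sub_zero, Pi.single_eq_same] at h3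
    exact ⟨_, h3.symm⟩
  have hmk : ∀ i : Fin n, Ideal.Quotient.mk J (alpha F ^ (n - (i : ℕ))) = (r i : Order F ⧸ J) := by
    intro i
    rw [← map_intCast (Ideal.Quotient.mk J), Ideal.Quotient.eq, hJ]
    convert ofCoords_row_mem_latticeOf (cyclicMatrix m r) i.castSucc using 1
    simp [hlast, sub_eq_add_neg]
  -- every element of `ℤ[α]`, and in particular `α`, is congruent to an integer modulo `J`
  have hrange : ∀ x : Order F, Ideal.Quotient.mk J x ∈ (Int.castRingHom (Order F ⧸ J)).range := by
    intro x
    obtain ⟨v, hv⟩ := S.exists_ofCoords_eq x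
    have h1 : x = ∑ k : Fin (n + 1), (v k : Order F) * alpha F ^ (n - (k : ℕ)) := by
      apply IsFractionRing.injective (Order F) (Fld F)
      rw [← hv, ofCoords_apply, map_sum]
      simp
    rw [h1, map_sum]
    refine sum_mem fun k _ => ?_
    rw [map_mul, map_intCast]
    refine mul_mem ⟨_, rfl⟩ ?_
    induction k using Fin.lastCases with
    | last => simp
    | cast k => exact ⟨r k, (hmk k).symm⟩
  obtain ⟨μ, hμ⟩ := hrange (alpha F)
  rw [eq_intCast] at hμ
  refine ⟨μ, ?_, fun i => ?_⟩
  · refine (Int.modEq_zero_iff_dvd).mpr (hint _ ?_)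
    have h1 := Polynomial.hom_eval₂ F (AdjoinRoot.of F) (Ideal.Quotient.mk J) (alpha F)
    rw [AdjoinRoot.eval₂_root, map_zero, ← hμ,
      RingHom.ext_int ((Ideal.Quotient.mk J).comp (AdjoinRoot.of F)) (Int.castRingHom _),
      Polynomial.eval₂_at_intCast] at h1
    simpa using h1.symm
  · refine (Int.modEq_iff_dvd).mpr (hint _ ?_)
    rw [Int.cast_sub, Int.cast_pow, hμ, ← hmk, map_pow, sub_self]

/-! ### Narrow classes -/

section Classes

variable (S : Choices F n)

/-- Every invertible fractional ideal is `x I_l` for a representative `I_l` and some `x` in the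
fundamental domain. -/
theorem exists_spanSingleton_mul_eq {J : FractionalIdeal (Order F)⁰ (Fld F)} (hJ : IsUnit J) :
    ∃ l, ∃ x ∈ S.D, x ≠ 0 ∧
      FractionalIdeal.spanSingleton (Order F)⁰ x *
      (S.I l : FractionalIdeal (Order F)⁰ (Fld F)) = J := by
  refine ⟨(hJ.unit : NarrowClassGroup F), ?_⟩
  set l : NarrowClassGroup F := (hJ.unit : NarrowClassGroup F) with hl
  obtain ⟨x, hx, hxJ⟩ := QuotientGroup.eq.mp ((S.class_I l).trans hl)
  obtain ⟨y, ⟨hyD, ε, -, hy⟩, -⟩ := S.isFundDomain.existsUnique x x.ne_zero hx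
  have hyx : FractionalIdeal.spanSingleton (Order F)⁰ y =
      FractionalIdeal.spanSingleton (Order F)⁰ (x : Fld F) :=
    (FractionalIdeal.spanSingleton_eq_spanSingleton.mpr
      ⟨ε, by rw [hy, Units.smul_def, Algebra.smul_def]⟩).symm
  refine ⟨y, hyD, ?_, ?_⟩
  · rw [hy]
    exact mul_ne_zero ((ε.isUnit.map _).ne_zero) x.ne_zero
  · have h1 := congrArg Units.val (eq_inv_mul_iff_mul_eq.mp hxJ)
    rw [hyx, mul_comm]
    simpa using h1

/-- The two factors in `x I_l` are determined by the product: the class of `x I_l` gives `l`, and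
then `x` is determined up to a totally positive unit. -/
theorem eq_of_spanSingleton_mul_eq {l l' : NarrowClassGroup F} {x y : Fld F} (hx : x ∈ S.D)
    (hy : y ∈ S.D) (hx0 : x ≠ 0) (hy0 : y ≠ 0)
    (h : FractionalIdeal.spanSingleton (Order F)⁰ x *
        (S.I l : FractionalIdeal (Order F)⁰ (Fld F)) =
      FractionalIdeal.spanSingleton (Order F)⁰ y *
        (S.I l' : FractionalIdeal (Order F)⁰ (Fld F))) : l = l' ∧ x = y := by
  have hxt := S.isFundDomain.totPos x hx
  have hyt := S.isFundDomain.totPos y hy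
  have hl : l = l' := by
    rw [← S.class_I l, ← S.class_I l', QuotientGroup.eq]
    refine ⟨Units.mk0 x hx0 * (Units.mk0 y hy0)⁻¹,
      (totPosUnits F).mul_mem hxt ((totPosUnits F).inv_mem hyt), ?_⟩
    rw [eq_inv_mul_iff_mul_eq, map_mul, map_inv, ← mul_assoc, mul_inv_eq_iff_eq_mul]
    apply Units.ext
    simpa [mul_comm] using h
  subst hl
  refine ⟨rfl, ?_⟩
  have h1 : FractionalIdeal.spanSingleton (Order F)⁰ x =
      FractionalIdeal.spanSingleton (Order F)⁰ y := (S.isUnit_I l).mul_right_cancel h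
  obtain ⟨ε, hε⟩ := FractionalIdeal.spanSingleton_eq_spanSingleton.mp h1
  rw [Units.smul_def, Algebra.smul_def] at hε
  refine (S.isFundDomain.existsUnique x hx0 hxt).unique
    ⟨hx, 1, fun φ => by simp, by simp⟩ ⟨hy, ε, fun φ => ?_, hε.symm⟩
  have h2 := hyt φ
  rw [← hε, map_mul] at h2
  exact pos_of_mul_pos_left h2 (hxt φ).le

/-- If `x I_l` is integral, then `x` lies in the inverse of `I_l`, so it has coordinates in the basis
`βbar l`. -/
theorem exists_ξ_eq {l : NarrowClassGroup F} {x : Fld F} {J : Ideal (Order F)}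
    (h : FractionalIdeal.spanSingleton (Order F)⁰ x *
        (S.I l : FractionalIdeal (Order F)⁰ (Fld F)) = J) : ∃ c, S.ξ l c = x := by
  have h0 : (S.I l : FractionalIdeal (Order F)⁰ (Fld F)) ≠ 0 := (S.isUnit_I l).ne_zero
  have hx : x ∈ (S.I l : FractionalIdeal (Order F)⁰ (Fld F))⁻¹ := by
    refine (FractionalIdeal.mem_inv_iff h0).mpr fun y hy => ?_
    refine FractionalIdeal.coeIdeal_le_one (I := J) ?_
    rw [← h]
    exact FractionalIdeal.mem_singleton_mul.mpr ⟨y, hy, rfl⟩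
  refine ⟨(S.βbar l).repr ⟨x, hx⟩, ?_⟩
  have h1 := congrArg Subtype.val ((S.βbar l).sum_repr ⟨x, hx⟩)
  rw [Submodule.coe_sum] at h1
  refine Eq.trans (Finset.sum_congr rfl fun i _ => ?_) h1
  rw [Submodule.coe_smul_of_tower, zsmul_eq_mul]

end Classes

end Choices

end RootParam

theorem theorem1p5 (F : ℤ[X]) [Fact (Irreducible F)] (hF : F.Monic) (n : ℕ)
    (hn : F.natDegree = n + 1) (S : RootParam.Choices F n) :
    (∀ (l : RootParam.NarrowClassGroup F) (c : Fin (n + 1) → ℤ), S.Admissible hF l c →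
      ∃ m μ : ℤ, 0 < m ∧ F.eval μ ≡ 0 [ZMOD m] ∧ S.Yields hF l c m μ) ∧
    (∀ m μ : ℤ, 0 < m → F.eval μ ≡ 0 [ZMOD m] →
      ∀ J : Ideal (RootParam.Order F), RootParam.CorrespondsTo n m μ J →
      IsUnit (J : FractionalIdeal (RootParam.Order F)⁰ (RootParam.Fld F)) →
      ∃ (l : RootParam.NarrowClassGroup F) (c : Fin (n + 1) → ℤ),
        S.Admissible hF l c ∧ S.Yields hF l c m μ ∧
        ∀ (l' : RootParam.NarrowClassGroup F) (c' : Fin (n + 1) → ℤ), S.Admissible hF l' c' →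
          (∃ u r, RootParam.IsBezoutCol (S.C hF l' c') u ∧ RootParam.IsPowerReps m μ r ∧
            S.Relates hF l' c' u m r) →
          l' = l ∧ c' = c) := by
  open RootParam in
  refine ⟨fun l c hlc => ?_, fun m μ hm _ J hJ hJu => ?_⟩
  · obtain ⟨u, hu⟩ := exists_isBezoutCol hlc.2
    obtain ⟨r, hr⟩ := hu.exists_eq_mul_cyclicMatrix
    have hU := isBezoutCol_iff.mp hu
    have hpos := S.det_C_pos hF hn (S.isFundDomain.totPos _ hlc.1) (hlc.ξ_ne_zero S hF)
    obtain ⟨μ, hμ, hrμ⟩ := S.exists_isPowerReps (m := (S.C hF l c).det) (r := r)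
      (J := ((FractionalIdeal.spanSingleton (Order F)⁰ (S.ξ l c) *
        (S.I l : FractionalIdeal (Order F)⁰ (Fld F)) : FractionalIdeal (Order F)⁰ (Fld F)) :
          Submodule (Order F) (Fld F)).comap (Algebra.linearMap (Order F) (Fld F)))
      fun x => by
        rw [← latticeOf_mul_of_det_eq_one hU, ← hr]
        exact S.mem_ξ_mul_I_iff hF hn l c
    exact ⟨_, μ, hpos, hμ, S.yields_of_eq_mul hF hn hpos hU hrμ hr⟩
  · -- the lattice `ξ I_l` is spanned by `C (α^n, …, 1)ᵗ` and `J` by `M (α^n, …, 1)ᵗ`, so that the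
    -- equality of the two ideals becomes `C = U * M` with `U` unimodular
    set M := cyclicMatrix m fun i : Fin n => μ ^ (n - (i : ℕ))
    have hMdet : M.det = m := det_cyclicMatrix _ _
    obtain ⟨l, x, hxD, hx0, hxJ⟩ := S.exists_spanSingleton_mul_eq hJu
    obtain ⟨c, rfl⟩ := S.exists_ξ_eq hxJ
    have hlat : latticeOf F (S.C hF l c) = latticeOf F M := by
      ext y
      rw [← S.mem_ξ_mul_I_iff hF hn, hxJ, hJ.mem_coeIdeal_iff]
    obtain ⟨U, hU, hC⟩ := exists_eq_mul_of_latticeOf_eq S.ofCoords_injective hlat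
      (S.det_C_pos hF hn (S.isFundDomain.totPos _ hxD) hx0) (hMdet.symm ▸ hm)
    have hY := S.yields_of_eq_mul hF hn hm hU (fun i => Int.ModEq.refl (μ ^ (n - (i : ℕ)))) hC
    refine ⟨l, c, ⟨hxD, hY.1.elim fun u hu => hu.gcd_minorDet⟩, hY, ?_⟩
    rintro l' c' hlc' ⟨u, r, hu, hr, hrel⟩
    have hC' := (S.relates_iff hF hn hu).mp hrel
    obtain ⟨E, hE, hEr⟩ := exists_mul_cyclicMatrix_of_modEq fun i => (hr i).symm
    have hlat' : latticeOf F (S.C hF l' c') = latticeOf F M := by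
      rw [hC', latticeOf_mul_of_det_eq_one (isBezoutCol_iff.mp hu), hEr,
        latticeOf_mul_of_det_eq_one hE]
    obtain ⟨rfl, hξ⟩ := S.eq_of_spanSingleton_mul_eq hlc'.1 hxD (hlc'.ξ_ne_zero S hF) hx0 <| by
      ext y
      rw [S.mem_ξ_mul_I_iff hF hn, S.mem_ξ_mul_I_iff hF hn, hlat, hlat']
    exact ⟨rfl, S.ξ_injective _ hξ⟩
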